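/- Let $\mathcal X$ be a Borel subset of $\mathbb R^d$, $\mu$ a probability measure on $\mathcal X$, $\|g\|^2=\int g^2\,d\mu$, and let $f,f_1,\dots,f_M:\mathcal X\to\mathbb R$ be measurable functions with $\sup_x|f(x)|\le L$ and $\sup_x|f_j(x)|\le L$, where $L<\infty$. Let $X_1,\dots,X_n$ be i.i.d. with law $\mu$, and $Y_i=f(X_i)+W_i$, where $W_1,\dots,W_n$ are i.i.d. $N(0,\sigma^2)$ with $\sigma>0$, independent of $(X_1,\dots,X_n)$. For $\lambda\in\mathbb R^M$ put $$\mathsf f_\lambda=\sum_{j=1}^M\lambda_jf_j,\qquad M(\lambda)=\#\{j:\lambda_j\neq0\},\qquad \widehat S(\lambda)=\frac1n\sum_{i=1}^n\{Y_i-\mathsf f_\lambda(X_i)\}^2,$$ $$\mathrm{pen}(\lambda)=K_1\frac{M(\lambda)}n\log\Bigl(1+\frac{M\vee n}{M(\lambda)\vee1}\Bigr).$$ For $0<T<\infty$ let $\Lambda_{M,T}=\{\lambda\in\mathbb R^M:\sum_{j=1}^M|\lambda_j|\le T\}$ and $B=L^2(T+1)^2$, and let $\widetilde f=\mathsf f_{\widehat\lambda}$,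 where $\widehat\lambda$ is a (measurable) minimizer of $\widehat S(\lambda)+\mathrm{pen}(\lambda)$ over $\lambda\in\Lambda_{M,T}$. There are an absolute constant $C_2>0$ and a threshold $K_0=K_0(a,B,\sigma^2)>0$, defined for all $a>1$, $B\ge0$ and $\sigma>0$, such that for every $\rho\ge1$ there is a constant $C_1=C_1(\rho,B,\sigma^2)>0$ (not depending on $a,n,M,f,f_1,\dots,f_M,\mathcal X,\mu$) with the following property. For all $a>1$, all $K_1$ with $K_0\le K_1\le\rho K_0$, all integers $n\ge1$ and $M\ge2$, and all $\mathcal X,\mu,f,f_1,\dots,f_M,L,T$ as above with $L^2(T+1)^2=B$, $$\mathbb E\|\widetilde f-f\|^2\le\inf_{\lambda\in\Lambda_{M,T}}\Bigl\{\frac{a+1}{a-1}\|\mathsf f_\lambda-f\|^2+C_1a\sigma^2\frac{M(\lambda)}n\log\Bigl(1+\frac{M\vee n}{M(\lambda)\vee1}\Bigr)\Bigr\}+C_2\frac{a(\sigma^2+B)}n .$$ -/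

import Mathlib

open MeasureTheory ProbabilityTheory

noncomputable section

namespace Aggregation

/-- The linear combination `f_λ(x) = ∑ j, λ_j f_j(x)`. -/
def comb {𝒳 : Type*} {M : ℕ} (F : Fin M → 𝒳 → ℝ) (lam : Fin M → ℝ) (x : 𝒳) : ℝ :=
  ∑ j, lam j * F j x

/-- The squared `L²(μ)` distance `‖g - h‖² = ∫ (g - h)² dμ`. -/
def sqDist {𝒳 : Type*} [MeasurableSpace 𝒳] (μ : Measure 𝒳) (g h : 𝒳 → ℝ) : ℝ :=
  ∫ x, (g x - h x) ^ 2 ∂μ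

/-- The residual sum of squares `Ŝ(λ) = n⁻¹ ∑ i, (y_i - f_λ(x_i))²` of the data `(x_i, y_i)`. -/
def rss {𝒳 : Type*} {M n : ℕ} (F : Fin M → 𝒳 → ℝ) (x : Fin n → 𝒳) (y : Fin n → ℝ)
    (lam : Fin M → ℝ) : ℝ :=
  (1 / (n : ℝ)) * ∑ i, (y i - comb F lam (x i)) ^ 2

/-- `(M(λ)/n) log(1 + (M ∨ n)/(M(λ) ∨ 1))`, where the number `M(λ)` of nonzero coordinates of `λ`
is Mathlib's `hammingNorm`. -/
def complexity (n : ℕ) {M : ℕ} (lam : Fin M → ℝ) : ℝ :=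
  ((hammingNorm lam : ℝ) / (n : ℝ)) *
    Real.log (1 + (max M n : ℝ) / (max (hammingNorm lam : ℝ) 1))

/-- The hard threshold penalty with factor `K₁`. -/
def pen (K₁ : ℝ) (n : ℕ) {M : ℕ} (lam : Fin M → ℝ) : ℝ :=
  K₁ * complexity n lam

/-- The `ℓ¹`-ball `Λ_{M,T}` of radius `T` in `ℝ^M`. -/
def l1Ball (M : ℕ) (T : ℝ) : Set (Fin M → ℝ) :=
  {lam | ∑ j, |lam j| ≤ T}

/-- `lam` is a minimizer over `Λ_{M,T}` of the penalized residual sum of squares. -/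
def IsPenalizedLSE {𝒳 : Type*} {M n : ℕ} (F : Fin M → 𝒳 → ℝ) (T K₁ : ℝ)
    (x : Fin n → 𝒳) (y : Fin n → ℝ) (lam : Fin M → ℝ) : Prop :=
  lam ∈ l1Ball M T ∧ ∀ lam' ∈ l1Ball M T,
    rss F x y lam + pen K₁ n lam ≤ rss F x y lam' + pen K₁ n lam'

/-- Random design and Gaussian noise: the pairs `(X_i, W_i)` are independent, `X_i` has law `μ`,
and `W_i` is `N(0, σ²)` and independent of `X_i`. -/
structure IsGaussianDesign {𝒳 Ω : Type*} [MeasurableSpace 𝒳] [MeasurableSpace Ω] {n : ℕ}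
    (P : Measure Ω) (μ : Measure 𝒳) (σ : ℝ) (X : Fin n → Ω → 𝒳) (W : Fin n → Ω → ℝ) : Prop where
  law_X : ∀ i, HasLaw (X i) μ P
  law_W : ∀ i, HasLaw (W i) (gaussianReal 0 ⟨σ ^ 2, sq_nonneg σ⟩) P
  indep_pairs : iIndepFun (fun i ω => (X i ω, W i ω)) P
  indep_noise : ∀ i, IndepFun (X i) (W i) P

end Aggregation

end

/-! Write `R(λ)` for the empirical risk minus the noise energy. It is unbiased for `‖f_λ - f‖²`, and
minimizing the penalized residual sum is minimizing `R + pen`. The risk of `f_λ` equals `α R(λ)`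
plus the gap `riskGap`, so the gap at the data-dependent `λ̂` must be controlled up to `α pen(λ̂)`.

For a fixed `λ` in the ball and `s` small relative to `σ² + B`, the gap has `E exp(s n riskGap) ≤ 1`
(`lintegral_exp_riskGap_le_one`): the surplus `α - 1` pays for the variance of noise and design.
This passes to the grid of mesh `T/n` in the `ℓ¹`-ball, because the number of grid points with `m`
nonzero coordinates is at most `(1 + (M ∨ n)/m)^(4m)` (`card_intBall_filter_le_pow`), and the
penalty outweighs its logarithm (`integral_sum_exp_riskGap_le`).

A derandomized Maurey argument (`exists_intBall_riskGap_le`) moves from any `λ` in the ball, hence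
from `λ̂`, to a grid point with no larger support, at cost `α (LT)²/n`. It acts on the gap itself
for given data, so the dependence of `λ̂` on the sample is harmless. Taking `α ≤ (a + 1)/(a - 1)`
bounded by an absolute constant gives the theorem. -/

namespace Aggregation

/-! ### Counting sparse grid points -/

/-- The integer points of the `ℓ¹`-ball of radius `n` in `ℝ^M`. -/
noncomputable def intBall (M n : ℕ) : Finset (Fin M → ℤ) :=
  (Fintype.piFinset fun _ => Finset.Icc (-(n : ℤ)) n).filter fun k => ∑ j, (k j).natAbs ≤ n

theorem mem_intBall {M n : ℕ} {k : Fin M → ℤ} :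
    k ∈ intBall M n ↔ ∑ j, (k j).natAbs ≤ n := by
  refine ⟨fun h => (Finset.mem_filter.1 h).2, fun h => Finset.mem_filter.2 ⟨?_, h⟩⟩
  refine Fintype.mem_piFinset.2 fun j => ?_
  have : (k j).natAbs ≤ ∑ j, (k j).natAbs :=
    Finset.single_le_sum (f := fun j => (k j).natAbs) (fun _ _ => Nat.zero_le _) (Finset.mem_univ j)
  rw [Finset.mem_Icc]
  omega

theorem sum_Icc_pow_natAbs_le (n : ℕ) {z y : ℝ} (hz0 : 0 ≤ z) (hz1 : z < 1) (hy : 0 ≤ y) :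
    ∑ i ∈ Finset.Icc (-(n : ℤ)) n, z ^ i.natAbs * (if i = 0 then 1 else y) ≤
      1 + 2 * y * (z / (1 - z)) := by
  rw [Finset.sum_Icc_of_even_eq_range (f := fun i : ℤ => z ^ i.natAbs * (if i = 0 then 1 else y))
    (fun i => by simp), Finset.sum_range_succ']
  have h1 : ∑ i ∈ Finset.range n, z ^ i ≤ 1 / (1 - z) := by
    have h := geom_sum_eq hz1.ne n
    have h2 : (z ^ n - 1) / (z - 1) = (1 - z ^ n) / (1 - z) := by
      rw [← neg_div_neg_eq]; ring
    rw [h, h2]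
    have : 0 < 1 - z := by linarith
    have : 0 ≤ z ^ n := by positivity
    gcongr
    linarith
  have h2 : ∑ i ∈ Finset.range n, (z ^ ((i + 1 : ℕ) : ℤ).natAbs *
      (if ((i + 1 : ℕ) : ℤ) = 0 then 1 else y)) = y * z * ∑ i ∈ Finset.range n, z ^ i := by
    rw [Finset.mul_sum]
    refine Finset.sum_congr rfl fun i _ => ?_
    rw [if_neg (by omega), Int.natAbs_natCast]
    ring
  rw [h2]
  have h3 := mul_le_mul_of_nonneg_left h1 (mul_nonneg hy hz0)
  have h4 : y * z * (1 / (1 - z)) = y * (z / (1 - z)) := by ring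
  simp only [Nat.cast_zero, Int.natAbs_zero, pow_zero, if_true, nsmul_eq_mul]
  push_cast
  linarith

/-- A generating function bound: each counted `k` has weight `z^|k|₁ y^m ≥ z^n y^m`, and the total
weight over the enclosing box factors over the coordinates. -/
theorem card_intBall_filter_le (M n m : ℕ) {z y : ℝ} (hz0 : 0 < z) (hz1 : z < 1) (hy : 0 < y) :
    (((intBall M n).filter fun k => hammingNorm k = m).card : ℝ) * (z ^ n * y ^ m) ≤
      (1 + 2 * y * (z / (1 - z))) ^ M := by
  have hprod : ∀ k : Fin M → ℤ, ∏ j, (z ^ (k j).natAbs * (if k j = 0 then 1 else y)) =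
      z ^ (∑ j, (k j).natAbs) * y ^ hammingNorm k := by
    intro k
    rw [Finset.prod_mul_distrib, Finset.prod_pow_eq_pow_sum]
    congr 1
    rw [hammingNorm, ← Finset.prod_const, Finset.prod_filter]
    exact Finset.prod_congr rfl fun j _ => by by_cases h : k j = 0 <;> simp [h]
  calc (((intBall M n).filter fun k => hammingNorm k = m).card : ℝ) * (z ^ n * y ^ m)
      = ∑ k ∈ (intBall M n).filter fun k => hammingNorm k = m, z ^ n * y ^ m := by simp
    _ ≤ ∑ k ∈ (intBall M n).filter fun k => hammingNorm k = m,
          ∏ j, (z ^ (k j).natAbs * (if k j = 0 then 1 else y)) := by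
        refine Finset.sum_le_sum fun k hk => ?_
        obtain ⟨hk1, hk2⟩ := Finset.mem_filter.1 hk
        rw [hprod, hk2]
        exact mul_le_mul_of_nonneg_right
          (pow_le_pow_of_le_one hz0.le hz1.le (mem_intBall.1 hk1)) (by positivity)
    _ ≤ ∑ k ∈ Fintype.piFinset fun _ : Fin M => Finset.Icc (-(n : ℤ)) n,
          ∏ j, (z ^ (k j).natAbs * (if k j = 0 then 1 else y)) := by
        refine Finset.sum_le_sum_of_subset_of_nonneg
          ((Finset.filter_subset _ _).trans (Finset.filter_subset _ _)) fun k _ _ => ?_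
        rw [hprod]
        positivity
    _ = ∏ _j : Fin M, ∑ i ∈ Finset.Icc (-(n : ℤ)) n, z ^ i.natAbs * (if i = 0 then 1 else y) := by
        rw [Finset.prod_univ_sum]
    _ ≤ (1 + 2 * y * (z / (1 - z))) ^ M := by
        rw [Finset.prod_const, Finset.card_univ, Fintype.card_fin]
        refine pow_le_pow_left₀ (Finset.sum_nonneg fun i _ => ?_)
          (sum_Icc_pow_natAbs_le n hz0.le hz1 hy.le) _
        split_ifs <;> positivity

theorem card_intBall_filter_le_pow {M n m : ℕ} (hm : 1 ≤ m) (hmM : m ≤ M) :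
    (((intBall M n).filter fun k => hammingNorm k = m).card : ℝ) ≤
      (1 + (max M n : ℝ) / m) ^ (4 * m) := by
  set N : ℝ := max (M : ℝ) n with hN
  have hm0 : (0 : ℝ) < m := by exact_mod_cast hm
  have hMN : (M : ℝ) ≤ N := le_max_left _ _
  have hnN : (n : ℝ) ≤ N := le_max_right _ _
  have hmN : (m : ℝ) ≤ N := le_trans (by exact_mod_cast hmM) hMN
  have hN0 : 0 < N := hm0.trans_le hmN
  set x : ℝ := N / m with hx
  have hx1 : 1 ≤ x := (one_le_div hm0).2 hmN
  have hx0 : 0 < x := by linarith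
  have hxm : (m : ℝ) * x = N := by rw [hx]; field_simp
  -- With these weights each coordinate factor is `1 + 1/x = z⁻¹`. Since `M, n ≤ N = m x`, its
  -- powers `M` and `n` are at most `e^m`, which leaves `(2 e² x²)^m`.
  have h := card_intBall_filter_le M n m (z := x / (1 + x)) (y := 1 / (2 * x ^ 2))
    (by positivity) ((div_lt_one (by positivity)).2 (by linarith)) (by positivity)
  have hr : 1 + 2 * (1 / (2 * x ^ 2)) * (x / (1 + x) / (1 - x / (1 + x))) = 1 + 1 / x := by
    have : 1 - x / (1 + x) = 1 / (1 + x) := by field_simp; ring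
    rw [this]; field_simp
  rw [hr] at h
  have hexp : ∀ k : ℕ, (k : ℝ) ≤ N → (1 + 1 / x) ^ k ≤ Real.exp m := by
    intro k hk
    calc (1 + 1 / x) ^ k ≤ (Real.exp (1 / x)) ^ k := by
          gcongr
          linarith [Real.add_one_le_exp (1 / x)]
      _ = Real.exp (k * (1 / x)) := by rw [← Real.exp_nat_mul]
      _ ≤ Real.exp m := by
          gcongr
          rw [mul_one_div, div_le_iff₀ hx0, hxm]
          exact hk
  have hz : (x / (1 + x)) ^ n = ((1 + 1 / x) ^ n)⁻¹ := by
    rw [← inv_pow]; congr 1; field_simp; ring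
  have hy : (1 / (2 * x ^ 2)) ^ m = ((2 * x ^ 2) ^ m)⁻¹ := by
    rw [← inv_pow]; congr 1; field_simp
  rw [hz, hy, ← mul_inv, ← div_eq_mul_inv, div_le_iff₀ (by positivity)] at h
  refine h.trans ?_
  calc (1 + 1 / x) ^ M * ((1 + 1 / x) ^ n * (2 * x ^ 2) ^ m)
      ≤ Real.exp m * (Real.exp m * (2 * x ^ 2) ^ m) := by
        have h1 := hexp M hMN
        have h2 := hexp n hnN
        gcongr
    _ = (Real.exp 1 ^ 2 * (2 * x ^ 2)) ^ m := by
        have hE : Real.exp m = Real.exp 1 ^ m := by rw [← Real.exp_nat_mul, mul_one]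
        rw [hE, mul_pow (Real.exp 1 ^ 2)]
        ring
    _ ≤ ((1 + x) ^ 4) ^ m := by
        have he := Real.exp_one_lt_d9
        have he0 := Real.exp_pos 1
        have h8 : Real.exp 1 ^ 2 ≤ 8 := by nlinarith
        have h4 : 16 * x ^ 2 ≤ (1 + x) ^ 4 := by
          nlinarith [sq_nonneg (x - 1), mul_nonneg (sq_nonneg (x - 1)) hx0.le]
        gcongr
        nlinarith [sq_nonneg x]
    _ = (1 + x) ^ (4 * m) := by rw [pow_mul]

theorem complexity_eq (n : ℕ) {M : ℕ} (lam : Fin M → ℝ) :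
    complexity n lam = (hammingNorm lam : ℝ) *
      Real.log (1 + (max M n : ℝ) / (max (hammingNorm lam : ℝ) 1)) / n := by
  rw [complexity]; ring

/-- Bernoulli's inequality with exponent `m'/m`, in logarithmic form. It lets the penalty decrease
when the support does not grow. -/
theorem mul_log_one_add_div_le {N : ℝ} (hN : 0 ≤ N) {m m' : ℕ} (h : m ≤ m') :
    (m : ℝ) * Real.log (1 + N / max (m : ℝ) 1) ≤ m' * Real.log (1 + N / max (m' : ℝ) 1) := by
  rcases Nat.eq_zero_or_pos m with rfl | hm
  · simp only [Nat.cast_zero, zero_mul]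
    have : 0 ≤ N / max (m' : ℝ) 1 := by positivity
    exact mul_nonneg (Nat.cast_nonneg _) (Real.log_nonneg (by linarith))
  have h1 : (1 : ℝ) ≤ m := by exact_mod_cast hm
  have h2 : (m : ℝ) ≤ m' := by exact_mod_cast h
  rw [max_eq_left h1, max_eq_left (h1.trans h2)]
  have hm0 : (0 : ℝ) < m := by linarith
  have hm'0 : (0 : ℝ) < m' := by linarith
  have hs : 0 ≤ N / m' := by positivity
  have hb := one_add_mul_self_le_rpow_one_add (s := N / m') (by linarith)
    (p := m' / m) ((one_le_div hm0).2 h2)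
  have he : (m' / m : ℝ) * (N / m') = N / m := by field_simp
  rw [he] at hb
  have hl := Real.log_le_log (by positivity) hb
  rw [Real.log_rpow (by positivity)] at hl
  calc (m : ℝ) * Real.log (1 + N / m) ≤ m * (m' / m * Real.log (1 + N / m')) := by gcongr
    _ = _ := by field_simp

theorem complexity_mono (n : ℕ) {M : ℕ} {lam lam' : Fin M → ℝ}
    (h : hammingNorm lam ≤ hammingNorm lam') : complexity n lam ≤ complexity n lam' := by
  rw [complexity_eq, complexity_eq]
  exact div_le_div_of_nonneg_right (mul_log_one_add_div_le (by positivity) h) (Nat.cast_nonneg n)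

/-- Counting costs `b^(4m)` and the weight supplies at least `b^(-5m)`, with `b = 1 + (M ∨ n)/m ≥ 2`
because `m ≤ M`. A factor `2^(-m)` survives, and the geometric series is at most 2. -/
theorem sum_intBall_exp_le (M n : ℕ) {c : ℝ} (hc : 5 ≤ c) :
    ∑ k ∈ intBall M n, Real.exp (-(c * ((hammingNorm k : ℝ) *
      Real.log (1 + (max M n : ℝ) / max (hammingNorm k : ℝ) 1)))) ≤ 2 := by
  have hmaps : ∀ k ∈ intBall M n, hammingNorm k ∈ Finset.range (M + 1) := fun k _ => by
    have := hammingNorm_le_card_fintype (x := k)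
    rw [Fintype.card_fin] at this
    exact Finset.mem_range.2 (by omega)
  rw [← Finset.sum_fiberwise_of_maps_to hmaps]
  have hfib : ∀ m ∈ Finset.range (M + 1), ∑ k ∈ (intBall M n).filter (fun k => hammingNorm k = m),
      Real.exp (-(c * ((hammingNorm k : ℝ) *
        Real.log (1 + (max M n : ℝ) / max (hammingNorm k : ℝ) 1)))) ≤ (1 / 2 : ℝ) ^ m := by
    intro m hm
    rw [Finset.sum_congr rfl (g := fun _ => Real.exp (-(c * ((m : ℝ) *
      Real.log (1 + (max M n : ℝ) / max (m : ℝ) 1))))) fun k hk => by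
        rw [(Finset.mem_filter.1 hk).2]]
    rw [Finset.sum_const, nsmul_eq_mul]
    rcases Nat.eq_zero_or_pos m with rfl | hm1
    · have : ((intBall M n).filter fun k => hammingNorm k = 0).card ≤ 1 := by
        refine Finset.card_le_one.2 fun a ha b hb => ?_
        rw [hammingNorm_eq_zero.1 (Finset.mem_filter.1 ha).2,
          hammingNorm_eq_zero.1 (Finset.mem_filter.1 hb).2]
      simpa using this
    have hmM : m ≤ M := Nat.lt_succ_iff.1 (Finset.mem_range.1 hm)
    have h1 : (1 : ℝ) ≤ m := by exact_mod_cast hm1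
    rw [max_eq_left h1]
    set b : ℝ := 1 + (max M n : ℝ) / m with hb
    have hb2 : 2 ≤ b := by
      have : (1 : ℝ) ≤ (max M n : ℝ) / m :=
        (one_le_div (by linarith)).2 (le_trans (by exact_mod_cast hmM) (le_max_left _ _))
      linarith
    have hb0 : 0 < b := by linarith
    have hlog : 0 ≤ Real.log b := Real.log_nonneg (by linarith)
    calc _ ≤ b ^ (4 * m) * Real.exp (-(5 * (m * Real.log b))) := by
          gcongr
          exact card_intBall_filter_le_pow hm1 hmM
      _ = b ^ (4 * m) * (b ^ (5 * m))⁻¹ := by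
          rw [Real.exp_neg]
          congr 2
          rw [← mul_assoc, show (5 * (m : ℝ)) = ((5 * m : ℕ) : ℝ) by push_cast; ring,
            Real.exp_nat_mul, Real.exp_log hb0]
      _ = (1 / b) ^ m := by
          rw [show 5 * m = 4 * m + m by ring, pow_add, one_div, inv_pow]
          field_simp
      _ ≤ (1 / 2) ^ m := by gcongr
  refine (Finset.sum_le_sum hfib).trans ?_
  have := geom_sum_eq (show (1 / 2 : ℝ) ≠ 1 by norm_num) (M + 1)
  rw [this]
  have : (0 : ℝ) ≤ (1 / 2) ^ (M + 1) := by positivity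
  rw [div_le_iff_of_neg (by norm_num)]
  linarith

/-! ### Exponential moments of the risk gap -/

theorem exp_neg_le_one_sub_add_sq {y : ℝ} (hy : 0 ≤ y) : Real.exp (-y) ≤ 1 - y + y ^ 2 := by
  have h := Real.add_one_le_exp y
  rw [Real.exp_neg]
  calc (Real.exp y)⁻¹ ≤ (y + 1)⁻¹ := by gcongr
    _ ≤ 1 - y + y ^ 2 := by
        rw [inv_le_iff_one_le_mul₀ (by linarith)]
        -- `(1 + y)(1 - y + y²) = 1 + y³`.
        nlinarith [pow_nonneg hy 3]

theorem lintegral_exp_neg_sq_le {𝒳 : Type*} [MeasurableSpace 𝒳] (μ : Measure 𝒳)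
    [IsProbabilityMeasure μ] {u : 𝒳 → ℝ} (hu : Measurable u) {B t s : ℝ}
    (hB : ∀ x, u x ^ 2 ≤ B) (ht : 0 ≤ t) (hts : s ≤ t * (1 - t * B)) :
    ∫⁻ x, ENNReal.ofReal (Real.exp (-(t * u x ^ 2))) ∂μ ≤
      ENNReal.ofReal (Real.exp (-(s * ∫ x, u x ^ 2 ∂μ))) := by
  have hint : Integrable (fun x => u x ^ 2) μ :=
    Integrable.of_bound (hu.pow_const 2).aestronglyMeasurable B
      (Filter.Eventually.of_forall fun x => by
        rw [Real.norm_of_nonneg (sq_nonneg _)]; exact hB x)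
  have hr : 0 ≤ ∫ x, u x ^ 2 ∂μ := integral_nonneg fun x => sq_nonneg _
  have hpt : ∀ x, Real.exp (-(t * u x ^ 2)) ≤ 1 - t * (1 - t * B) * u x ^ 2 := by
    intro x
    have h := exp_neg_le_one_sub_add_sq (mul_nonneg ht (sq_nonneg (u x)))
    have h2 : (t * u x ^ 2) ^ 2 ≤ t ^ 2 * B * u x ^ 2 := by
      have := mul_le_mul_of_nonneg_right (hB x) (mul_nonneg (sq_nonneg t) (sq_nonneg (u x)))
      nlinarith
    nlinarith
  have hint2 : Integrable (fun x => 1 - t * (1 - t * B) * u x ^ 2) μ :=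
    (integrable_const _).sub (hint.const_mul _)
  calc ∫⁻ x, ENNReal.ofReal (Real.exp (-(t * u x ^ 2))) ∂μ
      ≤ ∫⁻ x, ENNReal.ofReal (1 - t * (1 - t * B) * u x ^ 2) ∂μ :=
        lintegral_mono fun x => ENNReal.ofReal_le_ofReal (hpt x)
    _ = ENNReal.ofReal (∫ x, (1 - t * (1 - t * B) * u x ^ 2) ∂μ) :=
        (ofReal_integral_eq_lintegral_ofReal hint2 (Filter.Eventually.of_forall fun x =>
          (Real.exp_pos _).le.trans (hpt x))).symm
    _ ≤ ENNReal.ofReal (Real.exp (-(s * ∫ x, u x ^ 2 ∂μ))) := by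
        refine ENNReal.ofReal_le_ofReal ?_
        rw [integral_sub (integrable_const _) (hint.const_mul _), integral_const_mul]
        simp only [integral_const, probReal_univ, smul_eq_mul, mul_one]
        have h1 := Real.one_sub_le_exp_neg (s * ∫ x, u x ^ 2 ∂μ)
        have h2 := mul_le_mul_of_nonneg_right hts hr
        linarith

theorem lintegral_exp_mul_gaussianReal (v : NNReal) (c d : ℝ) :
    ∫⁻ w, ENNReal.ofReal (Real.exp (d + c * w)) ∂(gaussianReal 0 v) =
      ENNReal.ofReal (Real.exp (d + v * c ^ 2 / 2)) := by
  have hint : Integrable (fun w => Real.exp (d + c * w)) (gaussianReal 0 v) := by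
    simp_rw [Real.exp_add]
    exact (integrable_exp_mul_gaussianReal c).const_mul _
  rw [← ofReal_integral_eq_lintegral_ofReal hint
    (Filter.Eventually.of_forall fun _ => (Real.exp_pos _).le)]
  congr 1
  simp_rw [Real.exp_add]
  rw [integral_const_mul]
  have := mgf_gaussianReal (p := gaussianReal 0 v) (X := id) (μ := 0) (v := v) (by simp) c
  simp only [mgf, id, zero_mul, zero_add] at this
  rw [this]

/-- Integrating out the Gaussian noise turns the coefficient `-a` of `u²`, where `a = s α`, into
`-t` with `t = a (1 - 2 a v)`. The design then costs a factor `1 - t B`, and `hsα` leaves enough to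
cancel `s ∫ u²`. -/
theorem lintegral_exp_gap_le_one {𝒳 : Type*} [MeasurableSpace 𝒳] (μ : Measure 𝒳)
    [IsProbabilityMeasure μ] {u : 𝒳 → ℝ} (hu : Measurable u) {B α s : ℝ} {v : NNReal}
    (hB : ∀ x, u x ^ 2 ≤ B) (hs : 0 ≤ s) (hα : 0 ≤ α)
    (hsα : 1 ≤ α * (1 - s * α * (2 * (v + B)))) :
    ∫⁻ p, ENNReal.ofReal (Real.exp (s * (∫ x, u x ^ 2 ∂μ) -
      s * α * (u p.1 ^ 2 - 2 * p.2 * u p.1))) ∂(μ.prod (gaussianReal 0 v)) ≤ 1 := by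
  set r : ℝ := ∫ x, u x ^ 2 ∂μ with hr
  obtain ⟨x₀⟩ : Nonempty 𝒳 := nonempty_of_isProbabilityMeasure μ
  have hB0 : 0 ≤ B := (sq_nonneg _).trans (hB x₀)
  have hv0 : (0 : ℝ) ≤ v := v.2
  set a : ℝ := s * α with ha
  have ha0 : 0 ≤ a := mul_nonneg hs hα
  -- Otherwise the right side of `hsα` would be nonpositive. This gives `t ≥ 0`.
  have h1 : a * (2 * (v + B)) < 1 := by
    by_contra! h
    nlinarith
  set t : ℝ := a * (1 - 2 * a * v) with ht
  have hav : 0 ≤ a * v := mul_nonneg ha0 hv0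
  have haB : 0 ≤ a * B := mul_nonneg ha0 hB0
  have ht0 : 0 ≤ t := mul_nonneg ha0 (by nlinarith)
  have hta : t ≤ a := by nlinarith [mul_nonneg ha0 hav]
  have hst : s ≤ t * (1 - t * B) := by
    have h2 : t * (1 - a * B) ≤ t * (1 - t * B) := by gcongr
    have h3 : a * (1 - a * (2 * (v + B))) ≤ t * (1 - a * B) := by
      rw [ht, mul_assoc a]
      refine mul_le_mul_of_nonneg_left ?_ ha0
      nlinarith [mul_nonneg hav haB]
    have h4 : s * 1 ≤ s * (α * (1 - a * (2 * (v + B)))) := mul_le_mul_of_nonneg_left hsα hs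
    rw [← mul_assoc, ← ha] at h4
    linarith
  have hmeas : Measurable fun p : 𝒳 × ℝ =>
      ENNReal.ofReal (Real.exp (s * r - a * (u p.1 ^ 2 - 2 * p.2 * u p.1))) := by
    fun_prop
  rw [lintegral_prod _ hmeas.aemeasurable]
  have hin : ∀ x, ∫⁻ w, ENNReal.ofReal (Real.exp (s * r - a * (u x ^ 2 - 2 * w * u x)))
      ∂(gaussianReal 0 v) =
      ENNReal.ofReal (Real.exp (s * r)) * ENNReal.ofReal (Real.exp (-(t * u x ^ 2))) := by
    intro x
    have := lintegral_exp_mul_gaussianReal v (2 * a * u x) (s * r - a * u x ^ 2)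
    rw [← ENNReal.ofReal_mul (Real.exp_pos _).le, ← Real.exp_add]
    have e1 : s * r + -(t * u x ^ 2) = s * r - a * u x ^ 2 + v * (2 * a * u x) ^ 2 / 2 := by
      rw [ht]; ring
    rw [e1, ← this]
    refine lintegral_congr fun w => ?_
    ring_nf
  simp_rw [hin]
  rw [lintegral_const_mul _ (by fun_prop)]
  calc _ ≤ ENNReal.ofReal (Real.exp (s * r)) * ENNReal.ofReal (Real.exp (-(s * r))) := by
        gcongr
        exact lintegral_exp_neg_sq_le μ hu hB ht0 hst
    _ = 1 := by
        rw [← ENNReal.ofReal_mul (Real.exp_pos _).le, ← Real.exp_add]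
        simp

theorem iIndepFun.lintegral_prod_le_one {Ω E : Type*} [MeasurableSpace Ω] [MeasurableSpace E]
    {n : ℕ} {P : Measure Ω} [IsProbabilityMeasure P] {ν : Measure E} {Z : Fin n → Ω → E}
    (hZ : iIndepFun Z P) (hlaw : ∀ i, HasLaw (Z i) ν P) {g : E → ENNReal} (hg : Measurable g)
    (hg1 : ∫⁻ z, g z ∂ν ≤ 1) : ∫⁻ ω, ∏ i, g (Z i ω) ∂P ≤ 1 := by
  have hae : ∀ i, AEMeasurable (Z i) P := fun i => (hlaw i).aemeasurable
  -- The `Z i` are only a.e. measurable, so measurable versions carry the factorization.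
  have hY : iIndepFun (fun i => (hae i).mk) P := hZ.congr fun i => (hae i).ae_eq_mk
  have hY' := hY.comp (fun _ => g) (fun _ => hg)
  have hall : ∀ᵐ ω ∂P, ∀ i, Z i ω = (hae i).mk _ ω := ae_all_iff.2 fun i => (hae i).ae_eq_mk
  calc ∫⁻ ω, ∏ i, g (Z i ω) ∂P = ∫⁻ ω, ∏ i, (g ∘ (hae i).mk) ω ∂P :=
        lintegral_congr_ae (hall.mono fun ω h => by
          simp only [Function.comp_apply, h])
    _ = ∏ i, ∫⁻ ω, (g ∘ (hae i).mk) ω ∂P :=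
        lintegral_prod_eq_prod_lintegral_of_indepFun _ _ hY'
          fun i => hg.comp (hae i).measurable_mk
    _ ≤ 1 := Finset.prod_le_one' fun i _ => by
        have : ∫⁻ ω, (g ∘ (hae i).mk) ω ∂P = ∫⁻ ω, g (Z i ω) ∂P :=
          lintegral_congr_ae ((hae i).ae_eq_mk.mono fun ω h => by
            simp only [Function.comp_apply, h])
        rw [this, (hlaw i).lintegral_comp hg.aemeasurable]
        exact hg1

/-- The amount by which the risk of `f_λ` exceeds `α` times its centred empirical risk. -/
noncomputable def riskGap {𝒳 : Type*} [MeasurableSpace 𝒳] {M n : ℕ} (μ : Measure 𝒳) (f : 𝒳 → ℝ)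
    (F : Fin M → 𝒳 → ℝ) (α : ℝ) (x : Fin n → 𝒳) (w : Fin n → ℝ) (lam : Fin M → ℝ) : ℝ :=
  sqDist μ (comb F lam) f - α * ((1 / (n : ℝ)) *
    ∑ i, ((comb F lam (x i) - f (x i)) ^ 2 - 2 * w i * (comb F lam (x i) - f (x i))))

theorem measurable_comb {𝒳 : Type*} [MeasurableSpace 𝒳] {M : ℕ} {F : Fin M → 𝒳 → ℝ}
    (hF : ∀ j, Measurable (F j)) (lam : Fin M → ℝ) : Measurable (comb F lam) := by
  unfold comb
  fun_prop

theorem abs_comb_le {𝒳 : Type*} {M : ℕ} {F : Fin M → 𝒳 → ℝ} {L T : ℝ}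
    (hF : ∀ j x, |F j x| ≤ L) {lam : Fin M → ℝ} (hlam : lam ∈ l1Ball M T) (hL : 0 ≤ L) (x : 𝒳) :
    |comb F lam x| ≤ L * T := by
  calc |comb F lam x| ≤ ∑ j, |lam j * F j x| := Finset.abs_sum_le_sum_abs _ _
    _ ≤ ∑ j, |lam j| * L := by
        refine Finset.sum_le_sum fun j _ => ?_
        rw [abs_mul]
        exact mul_le_mul_of_nonneg_left (hF j x) (abs_nonneg _)
    _ = L * ∑ j, |lam j| := by rw [← Finset.sum_mul, mul_comm]
    _ ≤ L * T := mul_le_mul_of_nonneg_left hlam hL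

theorem sq_comb_sub_le {𝒳 : Type*} {M : ℕ} {F : Fin M → 𝒳 → ℝ} {f : 𝒳 → ℝ} {L T : ℝ}
    (hF : ∀ j x, |F j x| ≤ L) (hf : ∀ x, |f x| ≤ L) {lam : Fin M → ℝ} (hlam : lam ∈ l1Ball M T)
    (x : 𝒳) : (comb F lam x - f x) ^ 2 ≤ L ^ 2 * (T + 1) ^ 2 := by
  have hL : 0 ≤ L := (abs_nonneg _).trans (hf x)
  have h1 := abs_comb_le hF hlam hL x
  have h2 : |comb F lam x - f x| ≤ L * (T + 1) := by
    have := abs_sub (comb F lam x) (f x)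
    linarith [hf x]
  rw [← sq_abs, ← mul_pow]
  gcongr

theorem lintegral_exp_riskGap_le_one {𝒳 Ω : Type*} [MeasurableSpace 𝒳] [MeasurableSpace Ω]
    {M n : ℕ} (hn : 1 ≤ n) {μ : Measure 𝒳} [IsProbabilityMeasure μ] {P : Measure Ω}
    [IsProbabilityMeasure P] {f : 𝒳 → ℝ} {F : Fin M → 𝒳 → ℝ} (hf : Measurable f)
    (hF : ∀ j, Measurable (F j)) {σ : ℝ} {X : Fin n → Ω → 𝒳} {W : Fin n → Ω → ℝ}
    (hd : IsGaussianDesign P μ σ X W) {B α s : ℝ} (hs : 0 ≤ s) (hα : 0 ≤ α)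
    (hsα : 1 ≤ α * (1 - s * α * (2 * (σ ^ 2 + B)))) {lam : Fin M → ℝ}
    (hB : ∀ x, (comb F lam x - f x) ^ 2 ≤ B) :
    ∫⁻ ω, ENNReal.ofReal (Real.exp (s * n *
      riskGap μ f F α (fun i => X i ω) (fun i => W i ω) lam)) ∂P ≤ 1 := by
  have hu : Measurable fun x => comb F lam x - f x := (measurable_comb hF lam).sub hf
  have hmc := measurable_comb hF lam
  have h1 := lintegral_exp_gap_le_one μ hu (v := ⟨σ ^ 2, sq_nonneg σ⟩) hB hs hα hsα
  have hlaw : ∀ i, HasLaw (fun ω => (X i ω, W i ω))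
      (μ.prod (gaussianReal 0 ⟨σ ^ 2, sq_nonneg σ⟩)) P := fun i =>
    IndepFun.hasLaw_prod (hd.law_X i) (hd.law_W i) (hd.indep_noise i)
  refine le_trans (le_of_eq ?_) (iIndepFun.lintegral_prod_le_one hd.indep_pairs hlaw
    (by fun_prop) h1)
  refine lintegral_congr fun ω => ?_
  rw [← ENNReal.ofReal_prod_of_nonneg fun i _ => (Real.exp_pos _).le, ← Real.exp_sum]
  congr 2
  have hn0 : (n : ℝ) ≠ 0 := by positivity
  rw [Finset.sum_sub_distrib]
  simp only [Finset.sum_const, Finset.card_univ, Fintype.card_fin, nsmul_eq_mul]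
  rw [← Finset.mul_sum, riskGap, sqDist]
  field_simp

/-! ### Maurey approximation on the `ℓ¹`-ball -/

theorem exists_le_of_le_weighted_sum {ι : Type*} [Fintype ι] {p g : ι → ℝ} {c : ℝ}
    (hp0 : ∀ i, 0 ≤ p i) (hp1 : ∑ i, p i = 1) (h : c ≤ ∑ i, p i * g i) : ∃ i, c ≤ g i := by
  by_contra! hlt
  have hnn : ∀ i ∈ Finset.univ, 0 ≤ p i * (c - g i) := fun i _ =>
    mul_nonneg (hp0 i) (by linarith [hlt i])
  have hsum : ∑ i, p i * (c - g i) = c - ∑ i, p i * g i := by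
    simp_rw [mul_sub]
    rw [Finset.sum_sub_distrib, ← Finset.sum_mul, hp1, one_mul]
  have hz : ∑ i, p i * (c - g i) = 0 :=
    le_antisymm (by linarith) (Finset.sum_nonneg hnn)
  have hp : ∀ i, p i = 0 := fun i => by
    have := (Finset.sum_eq_zero_iff_of_nonneg hnn).1 hz i (Finset.mem_univ i)
    exact (mul_eq_zero.1 this).resolve_right (by linarith [hlt i])
  simp [hp] at hp1

theorem exists_int_sign (r : ℝ) : ∃ e : ℤ, e.natAbs ≤ 1 ∧ (r = 0 → e = 0) ∧ (e : ℝ) * |r| = r := by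
  rcases lt_trichotomy r 0 with h | h | h
  · exact ⟨-1, by simp, fun h0 => absurd h0 h.ne, by rw [abs_of_neg h]; simp⟩
  · exact ⟨0, by simp, fun _ => rfl, by simp [h]⟩
  · exact ⟨1, by simp, fun h0 => absurd h0 h.ne', by rw [abs_of_pos h]; simp⟩

/-- Every point of the `ℓ¹`-ball is a convex combination of signed, rescaled coordinate vectors
supported where the point is, and of `0`. -/
theorem exists_vertex_decomposition {M : ℕ} {T : ℝ} (hT : 0 < T) {lam : Fin M → ℝ}
    (hlam : lam ∈ l1Ball M T) :
    ∃ (p : Option (Fin M) → ℝ) (v : Option (Fin M) → Fin M → ℤ),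
      (∀ i, 0 ≤ p i) ∧ ∑ i, p i = 1 ∧ (∀ i, ∑ j, (v i j).natAbs ≤ 1) ∧
      (∀ i j, lam j = 0 → v i j = 0) ∧ ∀ j, ∑ i, p i * (T * v i j) = lam j := by
  choose e he1 he0 hemul using fun j => exists_int_sign (lam j)
  have hlam' : ∑ j, |lam j| ≤ T := hlam
  refine ⟨fun i => i.elim (1 - (∑ j, |lam j|) / T) fun j => |lam j| / T,
    fun i => i.elim 0 fun j => Pi.single j (e j), ?_, ?_, ?_, ?_, ?_⟩
  · rintro (_ | j)
    · exact sub_nonneg.2 ((div_le_one hT).2 hlam')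
    · exact div_nonneg (abs_nonneg _) hT.le
  · rw [Fintype.sum_option]
    simp only [Option.elim]
    rw [← Finset.sum_div]
    ring
  · rintro (_ | j)
    · simp
    · simp only [Option.elim]
      rw [Finset.sum_eq_single j (fun i _ hi => by simp [Pi.single_eq_of_ne hi]) (by simp)]
      simpa using he1 j
  · rintro (_ | i) j hj
    · simp
    · rcases eq_or_ne j i with rfl | hne
      · simpa using he0 j hj
      · simp [Pi.single_eq_of_ne hne]
  · intro j
    rw [Fintype.sum_option]
    simp only [Option.elim, Pi.zero_apply, Int.cast_zero, mul_zero, zero_add]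
    rw [Finset.sum_eq_single j (fun i _ hi => by simp [Pi.single_eq_of_ne hi.symm]) (by simp),
      Pi.single_eq_same]
    calc |lam j| / T * (T * (e j : ℝ)) = e j * |lam j| := by field_simp
      _ = lam j := hemul j

theorem integrable_sq_comb_sub {𝒳 : Type*} [MeasurableSpace 𝒳] (μ : Measure 𝒳)
    [IsProbabilityMeasure μ] {M : ℕ} {F : Fin M → 𝒳 → ℝ} {f : 𝒳 → ℝ} {L : ℝ}
    (hfm : Measurable f) (hFm : ∀ j, Measurable (F j)) (hf : ∀ x, |f x| ≤ L)
    (hF : ∀ j x, |F j x| ≤ L) (lam : Fin M → ℝ) :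
    Integrable (fun x => (comb F lam x - f x) ^ 2) μ :=
  Integrable.of_bound (((measurable_comb hFm lam).sub hfm).pow_const 2).aestronglyMeasurable _
    (Filter.Eventually.of_forall fun x => by
      rw [Real.norm_of_nonneg (sq_nonneg _)]
      -- The radius is the `ℓ¹` norm of `lam` itself, since the points met in a Maurey step are not
      -- confined to a given ball.
      exact sq_comb_sub_le hF hf (T := ∑ j, |lam j|) (le_refl (∑ j, |lam j|)) x)

/-- One Maurey step. Draw the vertex at random with mean `lam`: the increment of `comb` is centred
with second moment at most `(LT)²/n²`. The average risk can only grow, and the average empirical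
term grows by at most that variance, so some vertex does as well as the average gap. -/
theorem exists_le_riskGap_add {𝒳 : Type*} [MeasurableSpace 𝒳] {μ : Measure 𝒳}
    [IsProbabilityMeasure μ] {M n : ℕ} (hn : 1 ≤ n) {F : Fin M → 𝒳 → ℝ} {f : 𝒳 → ℝ} {L T α : ℝ}
    (hfm : Measurable f) (hFm : ∀ j, Measurable (F j)) (hf : ∀ x, |f x| ≤ L)
    (hF : ∀ j x, |F j x| ≤ L) (hT : 0 < T) (hα : 0 ≤ α) {lam : Fin M → ℝ}
    (hlam : lam ∈ l1Ball M T) (x : Fin n → 𝒳) (w : Fin n → ℝ) (base : Fin M → ℝ) :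
    ∃ v : Fin M → ℤ, ∑ j, (v j).natAbs ≤ 1 ∧ (∀ j, lam j = 0 → v j = 0) ∧
      riskGap μ f F α x w base - α * ((L * T) ^ 2 / (n : ℝ) ^ 2) ≤
        riskGap μ f F α x w fun j => base j + (T * v j - lam j) / n := by
  obtain ⟨p, v, hp0, hp1, hv1, hv0, hpv⟩ := exists_vertex_decomposition hT hlam
  have hn0 : (0 : ℝ) < n := by exact_mod_cast hn
  obtain ⟨x₀⟩ : Nonempty 𝒳 := nonempty_of_isProbabilityMeasure μ
  have hL : 0 ≤ L := (abs_nonneg _).trans (hf x₀)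
  set next : Option (Fin M) → Fin M → ℝ := fun i j => base j + (T * v i j - lam j) / n with hnext
  suffices h : ∃ i, riskGap μ f F α x w base - α * ((L * T) ^ 2 / (n : ℝ) ^ 2) ≤
      riskGap μ f F α x w (next i) by
    obtain ⟨i, hi⟩ := h
    exact ⟨v i, hv1 i, hv0 i, hi⟩
  refine exists_le_of_le_weighted_sum hp0 hp1 ?_
  set c : Option (Fin M) → 𝒳 → ℝ := fun i y => comb F (fun j => T * v i j) y with hc
  set b : Option (Fin M) → 𝒳 → ℝ := fun i y => (c i y - comb F lam y) / n with hb
  have hcomb : ∀ i y, comb F (next i) y = comb F base y + b i y := by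
    intro i y
    simp only [hb, hc, hnext, comb]
    rw [← Finset.sum_sub_distrib, Finset.sum_div, ← Finset.sum_add_distrib]
    exact Finset.sum_congr rfl fun j _ => by ring
  have hcL : ∀ i y, |c i y| ≤ L * T := fun i y => by
    refine abs_comb_le hF ?_ hL y
    change ∑ j, |T * (v i j : ℝ)| ≤ T
    have h1 : ∑ j, |(v i j : ℝ)| ≤ 1 := by
      have := hv1 i
      calc ∑ j, |(v i j : ℝ)| = ((∑ j, (v i j).natAbs : ℕ) : ℝ) := by
            push_cast
            exact Finset.sum_congr rfl fun j _ => by rw [Nat.cast_natAbs, Int.cast_abs]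
        _ ≤ 1 := by exact_mod_cast this
    simp_rw [abs_mul, abs_of_pos hT]
    rw [← Finset.mul_sum]
    nlinarith
  have hpc : ∀ y, ∑ i, p i * c i y = comb F lam y := by
    intro y
    simp only [hc, comb, Finset.mul_sum]
    rw [Finset.sum_comm]
    refine Finset.sum_congr rfl fun j _ => ?_
    rw [← hpv j, Finset.sum_mul]
    exact Finset.sum_congr rfl fun i _ => by ring
  have hpb : ∀ y, ∑ i, p i * b i y = 0 := by
    intro y
    have : ∑ i, p i * b i y = ((∑ i, p i * c i y) - (∑ i, p i) * comb F lam y) / n := by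
      rw [Finset.sum_mul, ← Finset.sum_sub_distrib, Finset.sum_div]
      exact Finset.sum_congr rfl fun i _ => by simp only [hb]; ring
    rw [this, hpc, hp1]
    simp
  -- The variance is bounded by the second moment, and vertices satisfy `|c i y| ≤ L T`.
  have hpb2 : ∀ y, ∑ i, p i * b i y ^ 2 ≤ (L * T) ^ 2 / (n : ℝ) ^ 2 := by
    intro y
    have h1 : ∑ i, p i * b i y ^ 2 = ((∑ i, p i * c i y ^ 2) -
        2 * comb F lam y * (∑ i, p i * c i y) + (∑ i, p i) * comb F lam y ^ 2) / (n : ℝ) ^ 2 := by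
      rw [Finset.sum_mul, Finset.mul_sum, ← Finset.sum_sub_distrib, ← Finset.sum_add_distrib,
        Finset.sum_div]
      exact Finset.sum_congr rfl fun i _ => by simp only [hb]; field_simp; ring
    have h2 : ∑ i, p i * c i y ^ 2 ≤ ∑ i, p i * (L * T) ^ 2 :=
      Finset.sum_le_sum fun i _ => mul_le_mul_of_nonneg_left
        (by rw [← sq_abs]; exact pow_le_pow_left₀ (abs_nonneg _) (hcL i y) 2) (hp0 i)
    rw [← Finset.sum_mul, hp1] at h2
    rw [h1, hpc, hp1]
    gcongr
    nlinarith [sq_nonneg (comb F lam y)]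
  have hlin : ∀ A y, ∑ i, p i * (A + b i y) = A := by
    intro A y
    simp_rw [mul_add]
    rw [Finset.sum_add_distrib, hpb, ← Finset.sum_mul, hp1]
    ring
  have hsq : ∀ A y, ∑ i, p i * (A + b i y) ^ 2 = A ^ 2 + ∑ i, p i * b i y ^ 2 := by
    intro A y
    have : ∑ i, p i * (A + b i y) ^ 2 =
        (∑ i, p i) * A ^ 2 + 2 * A * (∑ i, p i * b i y) + ∑ i, p i * b i y ^ 2 := by
      rw [Finset.sum_mul, Finset.mul_sum, ← Finset.sum_add_distrib, ← Finset.sum_add_distrib]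
      exact Finset.sum_congr rfl fun i _ => by ring
    rw [this, hpb, hp1]
    ring
  have hdist : sqDist μ (comb F base) f ≤ ∑ i, p i * sqDist μ (comb F (next i)) f := by
    have hint := fun lam => integrable_sq_comb_sub μ hfm hFm hf hF lam
    simp only [sqDist]
    simp_rw [← integral_const_mul]
    rw [← integral_finsetSum _ fun i _ => (hint (next i)).const_mul (p i)]
    refine integral_mono (hint base) (integrable_finsetSum _ fun i _ =>
      (hint (next i)).const_mul (p i)) fun y => ?_
    have : ∑ i, p i * (comb F (next i) y - f y) ^ 2 =
        (comb F base y - f y) ^ 2 + ∑ i, p i * b i y ^ 2 := by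
      rw [← hsq]
      exact Finset.sum_congr rfl fun i _ => by rw [hcomb]; ring
    simp only [this]
    have : 0 ≤ ∑ i, p i * b i y ^ 2 :=
      Finset.sum_nonneg fun i _ => mul_nonneg (hp0 i) (sq_nonneg _)
    linarith
  have hemp : ∑ i, p i * ((1 / (n : ℝ)) * ∑ t, ((comb F (next i) (x t) - f (x t)) ^ 2 -
        2 * w t * (comb F (next i) (x t) - f (x t)))) ≤
      (1 / (n : ℝ)) * ∑ t, ((comb F base (x t) - f (x t)) ^ 2 -
        2 * w t * (comb F base (x t) - f (x t))) + (L * T) ^ 2 / (n : ℝ) ^ 2 := by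
    have h1 : ∀ t, ∑ i, p i * ((comb F (next i) (x t) - f (x t)) ^ 2 -
        2 * w t * (comb F (next i) (x t) - f (x t))) ≤ ((comb F base (x t) - f (x t)) ^ 2 -
        2 * w t * (comb F base (x t) - f (x t))) + (L * T) ^ 2 / (n : ℝ) ^ 2 := by
      intro t
      have e : ∑ i, p i * ((comb F (next i) (x t) - f (x t)) ^ 2 -
          2 * w t * (comb F (next i) (x t) - f (x t))) =
          (∑ i, p i * ((comb F base (x t) - f (x t)) + b i (x t)) ^ 2) -
          2 * w t * ∑ i, p i * ((comb F base (x t) - f (x t)) + b i (x t)) := by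
        rw [Finset.mul_sum, ← Finset.sum_sub_distrib]
        exact Finset.sum_congr rfl fun i _ => by rw [hcomb]; ring
      rw [e, hsq, hlin]
      linarith [hpb2 (x t)]
    calc _ = (1 / (n : ℝ)) * ∑ t, ∑ i, p i * ((comb F (next i) (x t) - f (x t)) ^ 2 -
        2 * w t * (comb F (next i) (x t) - f (x t))) := by
          rw [Finset.sum_comm, Finset.mul_sum]
          refine Finset.sum_congr rfl fun i _ => ?_
          rw [← Finset.mul_sum]; ring
      _ ≤ (1 / (n : ℝ)) * ∑ t, (((comb F base (x t) - f (x t)) ^ 2 -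
        2 * w t * (comb F base (x t) - f (x t))) + (L * T) ^ 2 / (n : ℝ) ^ 2) := by
          gcongr with t
          exact h1 t
      _ = _ := by
          rw [Finset.sum_add_distrib, mul_add]
          congr 1
          simp only [Finset.sum_const, Finset.card_univ, Fintype.card_fin, nsmul_eq_mul]
          field_simp
  have hfin : ∑ i, p i * riskGap μ f F α x w (next i) =
      ∑ i, p i * sqDist μ (comb F (next i)) f -
      α * ∑ i, p i * ((1 / (n : ℝ)) * ∑ t, ((comb F (next i) (x t) - f (x t)) ^ 2 -
        2 * w t * (comb F (next i) (x t) - f (x t)))) := by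
    rw [Finset.mul_sum, ← Finset.sum_sub_distrib]
    exact Finset.sum_congr rfl fun i _ => by rw [riskGap]; ring
  rw [hfin, riskGap]
  have := mul_le_mul_of_nonneg_left hemp hα
  linarith

/-- Maurey's approximation: up to `α (L T)² / n`, the risk gap on the `ℓ¹`-ball is controlled by its
values on the grid of mesh `T / n`, without enlarging supports. -/
theorem exists_intBall_riskGap_le {𝒳 : Type*} [MeasurableSpace 𝒳] {μ : Measure 𝒳}
    [IsProbabilityMeasure μ] {M n : ℕ} (hn : 1 ≤ n) {F : Fin M → 𝒳 → ℝ} {f : 𝒳 → ℝ} {L T α : ℝ}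
    (hfm : Measurable f) (hFm : ∀ j, Measurable (F j)) (hf : ∀ x, |f x| ≤ L)
    (hF : ∀ j x, |F j x| ≤ L) (hT : 0 < T) (hα : 0 ≤ α) {lam : Fin M → ℝ}
    (hlam : lam ∈ l1Ball M T) (x : Fin n → 𝒳) (w : Fin n → ℝ) :
    ∃ k ∈ intBall M n, hammingNorm k ≤ hammingNorm lam ∧
      riskGap μ f F α x w lam ≤
        riskGap μ f F α x w (fun j => T / n * k j) + α * ((L * T) ^ 2 / n) := by
  have hn0 : (0 : ℝ) < n := by exact_mod_cast hn
  -- After `t` steps a fraction `t/n` of `lam` has been replaced by vertices; at `t = n` only a grid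
  -- point is left.
  have key : ∀ t : ℕ, ∃ k : Fin M → ℤ, ∑ j, (k j).natAbs ≤ t ∧ (∀ j, lam j = 0 → k j = 0) ∧
      riskGap μ f F α x w lam - t * (α * ((L * T) ^ 2 / (n : ℝ) ^ 2)) ≤
        riskGap μ f F α x w fun j => T / n * k j + (n - t) / n * lam j := by
    intro t
    induction t with
    | zero =>
      refine ⟨0, by simp, by simp, le_of_eq ?_⟩
      have : (fun j => T / n * ((0 : Fin M → ℤ) j : ℝ) + (n - (0 : ℕ)) / n * lam j) = lam := by
        funext j
        simp only [Pi.zero_apply, Int.cast_zero, Nat.cast_zero]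
        field_simp
        ring
      rw [this]
      simp
    | succ t ih =>
      obtain ⟨k, hk1, hk0, hk⟩ := ih
      obtain ⟨v, hv1, hv0, hv⟩ := exists_le_riskGap_add (μ := μ) hn hfm hFm hf hF hT hα hlam x w
        fun j => T / n * k j + (n - t) / n * lam j
      refine ⟨k + v, ?_, fun j hj => by simp [hk0 j hj, hv0 j hj], ?_⟩
      · calc ∑ j, ((k + v) j).natAbs ≤ ∑ j, ((k j).natAbs + (v j).natAbs) :=
              Finset.sum_le_sum fun j _ => Int.natAbs_add_le _ _
          _ ≤ t + 1 := by rw [Finset.sum_add_distrib]; omega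
      · have : (fun j => T / n * ((k + v) j : ℝ) + (n - (t + 1 : ℕ)) / n * lam j) =
            fun j => T / n * k j + (n - t) / n * lam j + (T * v j - lam j) / n := by
          funext j
          simp only [Pi.add_apply]
          push_cast
          field_simp
          ring
        rw [this]
        push_cast
        linarith
  obtain ⟨k, hk1, hk0, hk⟩ := key n
  refine ⟨k, mem_intBall.2 hk1, ?_, ?_⟩
  · refine Finset.card_le_card fun j hj => ?_
    simp only [Finset.mem_filter, Finset.mem_univ, true_and] at hj ⊢
    exact fun h => hj (hk0 j h)
  · simp only [sub_self, zero_div, zero_mul, add_zero] at hk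
    have : n * (α * ((L * T) ^ 2 / (n : ℝ) ^ 2)) = α * ((L * T) ^ 2 / n) := by field_simp
    linarith

/-! ### The scaled grid and the centred empirical risk -/

theorem scaled_intBall_mem_l1Ball {M n : ℕ} (hn : 1 ≤ n) {T : ℝ} (hT : 0 < T) {k : Fin M → ℤ}
    (hk : k ∈ intBall M n) : (fun j => T / n * (k j : ℝ)) ∈ l1Ball M T := by
  have hn0 : (0 : ℝ) < n := by exact_mod_cast hn
  change ∑ j, |T / n * (k j : ℝ)| ≤ T
  have h1 : ∑ j, |(k j : ℝ)| ≤ n := by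
    calc ∑ j, |(k j : ℝ)| = ((∑ j, (k j).natAbs : ℕ) : ℝ) := by
          push_cast
          exact Finset.sum_congr rfl fun j _ => by rw [Nat.cast_natAbs, Int.cast_abs]
      _ ≤ n := by exact_mod_cast mem_intBall.1 hk
  simp_rw [abs_mul, abs_of_pos (div_pos hT hn0)]
  rw [← Finset.mul_sum]
  calc T / n * ∑ j, |(k j : ℝ)| ≤ T / n * n := by gcongr
    _ = T := by field_simp

theorem hammingNorm_scaled {M n : ℕ} (hn : 1 ≤ n) {T : ℝ} (hT : 0 < T) (k : Fin M → ℤ) :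
    hammingNorm (fun j => T / n * (k j : ℝ)) = hammingNorm k := by
  have hn0 : (0 : ℝ) < n := by exact_mod_cast hn
  have h : T / n ≠ 0 := (div_pos hT hn0).ne'
  simp only [hammingNorm, ne_eq, mul_eq_zero, h, false_or, Int.cast_eq_zero]

/-- The noise energy does not depend on `lam`, so it cancels when two values of the criterion are
compared. -/
theorem rss_add_noise {𝒳 : Type*} {M n : ℕ} (F : Fin M → 𝒳 → ℝ) (f : 𝒳 → ℝ) (x : Fin n → 𝒳)
    (w : Fin n → ℝ) (lam : Fin M → ℝ) :
    rss F x (fun i => f (x i) + w i) lam = (1 / (n : ℝ)) * ∑ i, w i ^ 2 + (1 / (n : ℝ)) *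
      ∑ i, ((comb F lam (x i) - f (x i)) ^ 2 - 2 * w i * (comb F lam (x i) - f (x i))) := by
  rw [rss, ← mul_add, ← Finset.sum_add_distrib]
  congr 1
  exact Finset.sum_congr rfl fun i _ => by ring

theorem integrable_comp_of_hasLaw {Ω E : Type*} [MeasurableSpace Ω] [MeasurableSpace E]
    {P : Measure Ω} {ν : Measure E} {Z : Ω → E} (hZ : HasLaw Z ν P) {g : E → ℝ}
    (hg : Integrable g ν) : Integrable (fun ω => g (Z ω)) P := by
  rw [← hZ.map_eq] at hg
  exact hg.comp_aemeasurable hZ.aemeasurable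

/-! ### Oracle inequality for fixed `α` and `s` -/

section Design

variable {𝒳 Ω : Type*} [MeasurableSpace 𝒳] [MeasurableSpace Ω] {M n : ℕ} {μ : Measure 𝒳}
  {P : Measure Ω} {f : 𝒳 → ℝ} {F : Fin M → 𝒳 → ℝ} {σ : ℝ} {X : Fin n → Ω → 𝒳} {W : Fin n → Ω → ℝ}

theorem aemeasurable_riskGap (hfm : Measurable f) (hFm : ∀ j, Measurable (F j))
    (hd : IsGaussianDesign P μ σ X W) (α : ℝ) (lam : Fin M → ℝ) :
    AEMeasurable (fun ω => riskGap μ f F α (fun i => X i ω) (fun i => W i ω) lam) P := by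
  have hX := fun i => (hd.law_X i).aemeasurable
  have hW := fun i => (hd.law_W i).aemeasurable
  have hu : ∀ i, AEMeasurable (fun ω => comb F lam (X i ω) - f (X i ω)) P := fun i =>
    ((measurable_comb hFm lam).comp_aemeasurable (hX i)).sub (hfm.comp_aemeasurable (hX i))
  unfold riskGap
  refine aemeasurable_const.sub (AEMeasurable.const_mul (AEMeasurable.const_mul ?_ _) _)
  exact Finset.aemeasurable_fun_sum _ fun i _ =>
    ((hu i).pow_const 2).sub (((hW i).const_mul 2).mul (hu i))

variable [IsProbabilityMeasure μ]

theorem integral_centred_rss (hn : 1 ≤ n) (hfm : Measurable f)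
    (hFm : ∀ j, Measurable (F j)) (hd : IsGaussianDesign P μ σ X W) {L : ℝ}
    (hf : ∀ x, |f x| ≤ L) (hF : ∀ j x, |F j x| ≤ L) (lam : Fin M → ℝ) :
    Integrable (fun ω => (1 / (n : ℝ)) * ∑ i, ((comb F lam (X i ω) - f (X i ω)) ^ 2 -
      2 * W i ω * (comb F lam (X i ω) - f (X i ω)))) P ∧
    ∫ ω, (1 / (n : ℝ)) * ∑ i, ((comb F lam (X i ω) - f (X i ω)) ^ 2 -
      2 * W i ω * (comb F lam (X i ω) - f (X i ω))) ∂P = sqDist μ (comb F lam) f := by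
  have hn0 : (0 : ℝ) < n := by exact_mod_cast hn
  have hu : Measurable fun x => comb F lam x - f x := (measurable_comb hFm lam).sub hfm
  have husq := integrable_sq_comb_sub μ hfm hFm hf hF lam
  have hu1 : Integrable (fun x => comb F lam x - f x) μ :=
    ((memLp_two_iff_integrable_sq hu.aestronglyMeasurable).2 husq).integrable one_le_two
  have hA : ∀ i, Integrable (fun ω => (comb F lam (X i ω) - f (X i ω)) ^ 2) P := fun i =>
    integrable_comp_of_hasLaw (hd.law_X i) husq
  have hA1 : ∀ i, Integrable (fun ω => comb F lam (X i ω) - f (X i ω)) P := fun i =>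
    integrable_comp_of_hasLaw (hd.law_X i) hu1
  have hWi : ∀ i, Integrable (W i) P := fun i => by
    have : Integrable id (gaussianReal 0 ⟨σ ^ 2, sq_nonneg σ⟩) :=
      (memLp_id_gaussianReal 1).integrable le_rfl
    exact integrable_comp_of_hasLaw (hd.law_W i) this
  have hW0 : ∀ i, ∫ ω, W i ω ∂P = 0 := fun i =>
    (hd.law_W i).integral_eq.trans integral_id_gaussianReal
  have hind : ∀ i, IndepFun (W i) (fun ω => comb F lam (X i ω) - f (X i ω)) P := fun i =>
    ((hd.indep_noise i).symm.comp measurable_id hu :)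
  have hB : ∀ i, Integrable (fun ω => W i ω * (comb F lam (X i ω) - f (X i ω))) P := fun i =>
    (hind i).integrable_mul (hWi i) (hA1 i)
  have hB0 : ∀ i, ∫ ω, W i ω * (comb F lam (X i ω) - f (X i ω)) ∂P = 0 := fun i => by
    have := (hind i).integral_mul_eq_mul_integral (hWi i).aestronglyMeasurable
      (hA1 i).aestronglyMeasurable
    rw [hW0, zero_mul] at this
    exact this
  have hterm : ∀ i, Integrable (fun ω => (comb F lam (X i ω) - f (X i ω)) ^ 2 -
      2 * W i ω * (comb F lam (X i ω) - f (X i ω))) P := fun i => by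
    simp_rw [mul_assoc]
    exact (hA i).sub ((hB i).const_mul 2)
  have hval : ∀ i, ∫ ω, ((comb F lam (X i ω) - f (X i ω)) ^ 2 -
      2 * W i ω * (comb F lam (X i ω) - f (X i ω))) ∂P = sqDist μ (comb F lam) f := fun i => by
    simp_rw [mul_assoc]
    rw [integral_sub (hA i) ((hB i).const_mul 2), integral_const_mul, hB0, mul_zero, sub_zero]
    exact (hd.law_X i).integral_comp husq.aestronglyMeasurable
  refine ⟨(integrable_finsetSum _ fun i _ => hterm i).const_mul _, ?_⟩
  rw [integral_const_mul, integral_finsetSum _ fun i _ => hterm i]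
  simp only [hval, Finset.sum_const, Finset.card_univ, Fintype.card_fin, nsmul_eq_mul]
  field_simp

variable [IsProbabilityMeasure P]

/-- An exponential union bound over the whole grid: `n` cancels in `s n α pen`, leaving the weight
`s α K ≥ 5` that beats the count. -/
theorem integral_sum_exp_riskGap_le (hn : 1 ≤ n) (hfm : Measurable f)
    (hFm : ∀ j, Measurable (F j)) (hd : IsGaussianDesign P μ σ X W) {L T : ℝ}
    (hf : ∀ x, |f x| ≤ L) (hF : ∀ j x, |F j x| ≤ L) (hT : 0 < T) {α s K : ℝ} (hs : 0 ≤ s)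
    (hα : 0 ≤ α) (hsα : 1 ≤ α * (1 - s * α * (2 * (σ ^ 2 + L ^ 2 * (T + 1) ^ 2))))
    (hK : 5 ≤ s * α * K) :
    Integrable (fun ω => ∑ k ∈ intBall M n, Real.exp (s * n *
      (riskGap μ f F α (fun i => X i ω) (fun i => W i ω) (fun j => T / n * (k j : ℝ)) -
        α * pen K n (fun j => T / n * (k j : ℝ))))) P ∧
    ∫ ω, ∑ k ∈ intBall M n, Real.exp (s * n *
      (riskGap μ f F α (fun i => X i ω) (fun i => W i ω) (fun j => T / n * (k j : ℝ)) -
        α * pen K n (fun j => T / n * (k j : ℝ)))) ∂P ≤ 2 := by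
  have hn0 : (0 : ℝ) < n := by exact_mod_cast hn
  set G : (Fin M → ℤ) → Ω → ℝ := fun k ω => Real.exp (s * n *
      (riskGap μ f F α (fun i => X i ω) (fun i => W i ω) (fun j => T / n * (k j : ℝ)) -
        α * pen K n (fun j => T / n * (k j : ℝ)))) with hG
  have hGm : ∀ k, AEMeasurable (G k) P := fun k =>
    Real.measurable_exp.comp_aemeasurable
      (((aemeasurable_riskGap hfm hFm hd α _).sub aemeasurable_const).const_mul _)
  have hG0 : ∀ k ω, 0 ≤ G k ω := fun k ω => (Real.exp_pos _).le
  have hbound : ∀ k ∈ intBall M n, ∫⁻ ω, ENNReal.ofReal (G k ω) ∂P ≤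
      ENNReal.ofReal (Real.exp (-(s * α * K * ((hammingNorm k : ℝ) *
        Real.log (1 + (max M n : ℝ) / max (hammingNorm k : ℝ) 1))))) := by
    intro k hk
    have h1 := lintegral_exp_riskGap_le_one hn hfm hFm hd hs hα hsα
      (sq_comb_sub_le hF hf (scaled_intBall_mem_l1Ball hn hT hk))
    have h2 : ∀ ω, ENNReal.ofReal (G k ω) =
        ENNReal.ofReal (Real.exp (-(s * α * K * ((hammingNorm k : ℝ) *
          Real.log (1 + (max M n : ℝ) / max (hammingNorm k : ℝ) 1))))) *
        ENNReal.ofReal (Real.exp (s * n * riskGap μ f F α (fun i => X i ω) (fun i => W i ω)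
          (fun j => T / n * (k j : ℝ)))) := by
      intro ω
      rw [← ENNReal.ofReal_mul (Real.exp_pos _).le, ← Real.exp_add]
      simp only [hG]
      congr 2
      rw [pen, complexity_eq, hammingNorm_scaled hn hT]
      field_simp
      ring
    simp_rw [h2]
    rw [lintegral_const_mul' _ _ ENNReal.ofReal_ne_top]
    exact mul_le_of_le_one_right zero_le h1
  have hGi : ∀ k ∈ intBall M n, Integrable (G k) P := fun k hk =>
    (lintegral_ofReal_ne_top_iff_integrable (hGm k).aestronglyMeasurable
      (Filter.Eventually.of_forall (hG0 k))).1
      ((hbound k hk).trans_lt ENNReal.ofReal_lt_top).ne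
  refine ⟨integrable_finsetSum _ hGi, ?_⟩
  rw [integral_finsetSum _ hGi]
  refine le_trans (Finset.sum_le_sum fun k hk => ?_) (sum_intBall_exp_le M n hK)
  rw [integral_eq_lintegral_of_nonneg_ae (Filter.Eventually.of_forall (hG0 k))
    (hGm k).aestronglyMeasurable]
  exact ENNReal.toReal_le_of_le_ofReal (Real.exp_pos _).le (hbound k hk)

theorem integral_sqDist_penalizedLSE_le (hn : 1 ≤ n) (hfm : Measurable f)
    (hFm : ∀ j, Measurable (F j)) (hd : IsGaussianDesign P μ σ X W) {L T : ℝ}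
    (hf : ∀ x, |f x| ≤ L) (hF : ∀ j x, |F j x| ≤ L) (hT : 0 < T) {α s K : ℝ} (hs : 0 < s)
    (hα : 0 < α) (hsα : 1 ≤ α * (1 - s * α * (2 * (σ ^ 2 + L ^ 2 * (T + 1) ^ 2))))
    (hK : 5 ≤ s * α * K) {lamHat : Ω → Fin M → ℝ}
    (hmin : ∀ᵐ ω ∂P, IsPenalizedLSE F T K (fun i => X i ω)
      (fun i => f (X i ω) + W i ω) (lamHat ω)) {lam : Fin M → ℝ} (hlam : lam ∈ l1Ball M T) :
    ∫ ω, sqDist μ (comb F (lamHat ω)) f ∂P ≤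
      α * (sqDist μ (comb F lam) f + pen K n lam) + 2 / (s * n) + α * ((L * T) ^ 2 / n) := by
  have hn0 : (0 : ℝ) < n := by exact_mod_cast hn
  have hsn : 0 < s * n := mul_pos hs hn0
  have hK0 : 0 ≤ K := by
    by_contra! h
    nlinarith [mul_pos hs hα]
  obtain ⟨hGi, hG⟩ := integral_sum_exp_riskGap_le (M := M) hn hfm hFm hd hf hF hT hs.le hα.le hsα hK
  obtain ⟨hRi, hR⟩ := integral_centred_rss hn hfm hFm hd hf hF lam
  set Z : Ω → ℝ := fun ω => ∑ k ∈ intBall M n, Real.exp (s * n *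
      (riskGap μ f F α (fun i => X i ω) (fun i => W i ω) (fun j => T / n * (k j : ℝ)) -
        α * pen K n (fun j => T / n * (k j : ℝ)))) with hZ
  set R : Ω → ℝ := fun ω => (1 / (n : ℝ)) * ∑ i, ((comb F lam (X i ω) - f (X i ω)) ^ 2 -
      2 * W i ω * (comb F lam (X i ω) - f (X i ω))) with hRdef
  have hi1 : Integrable (fun ω => (s * n)⁻¹ * Z ω) P := hGi.const_mul _
  have hi2 : Integrable (fun ω => α * R ω) P := hRi.const_mul _
  have hi12 : Integrable (fun ω => (s * n)⁻¹ * Z ω + α * R ω) P := hi1.add hi2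
  have hpt : ∀ᵐ ω ∂P, sqDist μ (comb F (lamHat ω)) f ≤
      ((s * n)⁻¹ * Z ω + α * R ω) + (α * pen K n lam + α * ((L * T) ^ 2 / n)) := by
    filter_upwards [hmin] with ω hω
    have hle := hω.2 lam hlam
    rw [rss_add_noise, rss_add_noise] at hle
    obtain ⟨k, hk, hkh, hgap⟩ := exists_intBall_riskGap_le (μ := μ) hn hfm hFm hf hF hT hα.le hω.1
      (fun i => X i ω) (fun i => W i ω)
    have hpen : pen K n (fun j => T / n * (k j : ℝ)) ≤ pen K n (lamHat ω) := by
      refine mul_le_mul_of_nonneg_left (complexity_mono n ?_) hK0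
      rwa [hammingNorm_scaled hn hT]
    have hZk : riskGap μ f F α (fun i => X i ω) (fun i => W i ω) (fun j => T / n * (k j : ℝ)) -
        α * pen K n (fun j => T / n * (k j : ℝ)) ≤ (s * n)⁻¹ * Z ω := by
      -- Here `y ≤ exp y`, and one exponential is at most the sum `Z`. The grid point `k` may thus
      -- vary with `ω`.
      rw [inv_mul_eq_div, le_div_iff₀' hsn]
      have h1 := Real.add_one_le_exp (s * n * (riskGap μ f F α (fun i => X i ω) (fun i => W i ω)
        (fun j => T / n * (k j : ℝ)) - α * pen K n (fun j => T / n * (k j : ℝ))))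
      have h2 := Finset.single_le_sum (f := fun k : Fin M → ℤ => Real.exp (s * n *
        (riskGap μ f F α (fun i => X i ω) (fun i => W i ω) (fun j => T / n * (k j : ℝ)) -
        α * pen K n (fun j => T / n * (k j : ℝ))))) (fun _ _ => (Real.exp_pos _).le) hk
      simp only [hZ]
      linarith
    have h3 := mul_le_mul_of_nonneg_left hle hα.le
    have h4 := mul_le_mul_of_nonneg_left hpen hα.le
    have h5 : sqDist μ (comb F (lamHat ω)) f = riskGap μ f F α (fun i => X i ω) (fun i => W i ω)
        (lamHat ω) + α * ((1 / (n : ℝ)) * ∑ i, ((comb F (lamHat ω) (X i ω) - f (X i ω)) ^ 2 -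
          2 * W i ω * (comb F (lamHat ω) (X i ω) - f (X i ω)))) := by
      rw [riskGap]; ring
    simp only [hRdef]
    simp only [mul_add] at h3
    linarith
  have hnn : 0 ≤ᵐ[P] fun ω => sqDist μ (comb F (lamHat ω)) f :=
    Filter.Eventually.of_forall fun ω => integral_nonneg fun x => sq_nonneg _
  -- Only the upper bound has to be integrable, the risk of `lamHat` being nonnegative.
  refine (integral_mono_of_nonneg hnn (hi12.add (integrable_const _)) hpt).trans ?_
  have hval : ∫ ω, (((s * n)⁻¹ * Z ω + α * R ω) + (α * pen K n lam + α * ((L * T) ^ 2 / n))) ∂P =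
      (s * n)⁻¹ * ∫ ω, Z ω ∂P + α * sqDist μ (comb F lam) f +
        (α * pen K n lam + α * ((L * T) ^ 2 / n)) := by
    rw [integral_add hi12 (integrable_const _)]
    rw [integral_add hi1 hi2, integral_const_mul, integral_const_mul, hR]
    simp
  have hle : (s * n)⁻¹ * ∫ ω, Z ω ∂P ≤ 2 / (s * n) := by
    rw [inv_mul_eq_div]
    gcongr
  refine hval.le.trans ?_
  linarith

end Design

end Aggregation

/-! ### Choice of the constants -/

theorem theorem3p6 :
    ∃ C₂ : ℝ, 0 < C₂ ∧ ∀ B σ : ℝ, 0 ≤ B → 0 < σ →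
    -- a threshold `K₀` for the penalty factor, depending on `a`, `B` and `σ`
    ∃ K₀ : ℝ → ℝ, (∀ a : ℝ, 1 < a → 0 < K₀ a) ∧
    ∀ ρ : ℝ, 1 ≤ ρ → ∃ C₁ : ℝ, 0 < C₁ ∧
    ∀ a : ℝ, 1 < a → ∀ K₁ : ℝ, K₀ a ≤ K₁ → K₁ ≤ ρ * K₀ a →
    ∀ n M : ℕ, 1 ≤ n → 2 ≤ M →
    ∀ L T : ℝ, 0 < T → B = L ^ 2 * (T + 1) ^ 2 →
    ∀ (d : ℕ) (𝒳 : Set (EuclideanSpace ℝ (Fin d))), MeasurableSet 𝒳 →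
    ∀ (μ : Measure 𝒳) [IsProbabilityMeasure μ]
      (f : 𝒳 → ℝ) (F : Fin M → 𝒳 → ℝ),
      Measurable f → (∀ j, Measurable (F j)) →
      (∀ x, |f x| ≤ L) → (∀ j x, |F j x| ≤ L) →
    ∀ (Ω : Type*) [MeasurableSpace Ω] (P : Measure Ω) [IsProbabilityMeasure P]
      (X : Fin n → Ω → 𝒳) (W : Fin n → Ω → ℝ),
      Aggregation.IsGaussianDesign P μ σ X W →
    ∀ lamHat : Ω → Fin M → ℝ, AEMeasurable lamHat P →
      (∀ᵐ ω ∂P, Aggregation.IsPenalizedLSE F T K₁ (fun i => X i ω)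
        (fun i => f (X i ω) + W i ω) (lamHat ω)) →
      ∫ ω, Aggregation.sqDist μ (Aggregation.comb F (lamHat ω)) f ∂P ≤
        (⨅ lam : Aggregation.l1Ball M T,
          ((a + 1) / (a - 1) * Aggregation.sqDist μ (Aggregation.comb F lam) f +
            C₁ * a * σ ^ 2 * Aggregation.complexity n (lam : Fin M → ℝ))) +
        C₂ * (a * (σ ^ 2 + B) / n) := by
  -- `39 = 36 + 3`: 36 from `2/(s n)` and 3 from the Maurey error.
  refine ⟨39, by norm_num, fun B σ hB hσ => ?_⟩
  set V : ℝ := σ ^ 2 + B with hV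
  have hV0 : 0 < V := by positivity
  -- `(a + 1) / (a - 1)` is capped at `3`
  set α : ℝ → ℝ := fun a => (max a 2 + 1) / (max a 2 - 1) with hα
  -- This `s` solves `α (1 - 2 s α V) = 1`, the equality case of the exponential moment condition.
  set s : ℝ → ℝ := fun a => (α a - 1) / (α a ^ 2 * (2 * V)) with hs
  have hα1 : ∀ a, α a - 1 = 2 / (max a 2 - 1) := fun a => by
    have : (1 : ℝ) < max a 2 := lt_of_lt_of_le one_lt_two (le_max_right _ _)
    have h0 : max a 2 - 1 ≠ 0 := by linarith
    simp only [hα]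
    field_simp
    ring
  have hα0 : ∀ a, 1 < α a := fun a => by
    have : (1 : ℝ) < max a 2 := lt_of_lt_of_le one_lt_two (le_max_right _ _)
    have : 0 < 2 / (max a 2 - 1) := div_pos two_pos (by linarith)
    linarith [hα1 a]
  have hα3 : ∀ a, α a ≤ 3 := fun a => by
    have h2 : (2 : ℝ) ≤ max a 2 := le_max_right _ _
    have : 2 / (max a 2 - 1) ≤ 2 := div_le_self two_pos.le (by linarith)
    linarith [hα1 a]
  have hs0 : ∀ a, 0 < s a := fun a => by
    have h1 := hα0 a
    exact div_pos (by linarith) (by positivity)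
  -- The cap on `α` matters here: with `α = (a + 1)/(a - 1)`, `1/s` would blow up as `a → 1`.
  have hsinv : ∀ a, 1 < a → 1 / s a ≤ 18 * (a * V) := fun a ha => by
    have h2 : (2 : ℝ) ≤ max a 2 := le_max_right _ _
    have h2a : max a 2 - 1 ≤ 2 * a := by
      have : max a 2 ≤ 2 * a := max_le (by linarith) (by linarith)
      linarith
    have h0 : max a 2 - 1 ≠ 0 := by linarith
    have e : 1 / s a = α a ^ 2 * V * (max a 2 - 1) := by
      simp only [hs]
      rw [hα1 a, one_div_div]
      field_simp
    have h9 : α a ^ 2 ≤ 9 := by nlinarith [hα0 a, hα3 a]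
    rw [e]
    calc α a ^ 2 * V * (max a 2 - 1) ≤ 9 * V * (2 * a) :=
          mul_le_mul (mul_le_mul_of_nonneg_right h9 hV0.le) h2a (by linarith) (by positivity)
      _ = 18 * (a * V) := by ring
  have hsα : ∀ a, α a * (1 - s a * α a * (2 * V)) = 1 := fun a => by
    have h1 : α a ≠ 0 := by linarith [hα0 a]
    simp only [hs]
    field_simp
    ring
  -- `K₀` is the least `K` with `5 ≤ s α K`. Then `α K₁ ≤ 5 ρ / s ≤ 90 ρ a V`, and dividing by `a
  -- σ²` gives `C₁`.
  refine ⟨fun a => 5 / (s a * α a), fun a _ => div_pos (by norm_num)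
    (mul_pos (hs0 a) (by linarith [hα0 a])), fun ρ hρ => ⟨90 * ρ * V / σ ^ 2, by positivity, ?_⟩⟩
  intro a ha K₁ hK hKρ n M hn _ L T hT hBLT d 𝒳 _ μ _ f F hfm hFm hf hF Ω _ P _ X W hd lamHat _ hmin
  have hn0 : (0 : ℝ) < n := by exact_mod_cast hn
  have hα' : 0 < α a := by linarith [hα0 a]
  have hsα0 : 0 < s a * α a := mul_pos (hs0 a) hα'
  have : Nonempty (Aggregation.l1Ball M T) :=
    ⟨⟨0, by change ∑ j : Fin M, |(0 : ℝ)| ≤ T; simpa using hT.le⟩⟩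
  rw [← sub_le_iff_le_add]
  refine le_ciInf fun lam => ?_
  rw [sub_le_iff_le_add]
  have hmain := Aggregation.integral_sqDist_penalizedLSE_le (s := s a) (α := α a) (K := K₁) hn hfm
    hFm hd hf hF hT (hs0 a) hα' (by rw [← hBLT, ← hV, hsα]) (by
      rw [div_le_iff₀' hsα0] at hK
      exact hK) hmin lam.2
  refine hmain.trans ?_
  have hdist : 0 ≤ Aggregation.sqDist μ (Aggregation.comb F lam) f :=
    integral_nonneg fun x => sq_nonneg _
  have hcomp : 0 ≤ Aggregation.complexity n (lam : Fin M → ℝ) := by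
    have := Aggregation.complexity_mono n (lam := (0 : Fin M → ℝ)) (lam' := lam) (by simp)
    simpa [Aggregation.complexity] using this
  have hαa : α a ≤ (a + 1) / (a - 1) := by
    have h2 : a ≤ max a 2 := le_max_left _ _
    have e : (a + 1) / (a - 1) = 1 + 2 / (a - 1) := by
      have : a - 1 ≠ 0 := by linarith
      field_simp
      ring
    have : 2 / (max a 2 - 1) ≤ 2 / (a - 1) :=
      div_le_div_of_nonneg_left two_pos.le (by linarith) (by linarith)
    linarith [hα1 a]
  have h1 := mul_le_mul_of_nonneg_right hαa hdist
  have h2 : α a * K₁ ≤ 90 * ρ * V / σ ^ 2 * a * σ ^ 2 := by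
    calc α a * K₁ ≤ α a * (ρ * (5 / (s a * α a))) := by gcongr
      _ = 5 * ρ * (1 / s a) := by field_simp
      _ ≤ 5 * ρ * (18 * (a * V)) := by
          have := hsinv a ha
          gcongr
      _ = _ := by field_simp; ring
  have h3 := mul_le_mul_of_nonneg_right h2 hcomp
  have h4 : 2 / (s a * n) ≤ 36 * (a * V / n) := by
    calc 2 / (s a * n) = 2 * (1 / s a) / n := by
          have := (hs0 a).ne'
          field_simp
      _ ≤ 2 * (18 * (a * V)) / n := by
          have := hsinv a ha
          gcongr
      _ = _ := by ring
  have hLT : (L * T) ^ 2 ≤ a * V := by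
    have e1 : (L * T) ^ 2 ≤ B := by
      rw [hBLT, mul_pow]
      gcongr
      linarith
    have e2 : B ≤ V := by rw [hV]; linarith [sq_nonneg σ]
    nlinarith
  have h5 : α a * ((L * T) ^ 2 / n) ≤ 3 * (a * V / n) := by
    have := hα3 a
    gcongr
  rw [Aggregation.pen]
  linarith
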